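/- Let $\Gamma$ be a compact metric graph, that is, a connected graph with finite vertex set and finite edge set $E$ (loops and multiple edges are allowed), each edge $e$ being identified with an interval $[0,\ell_e]$ of length $\ell_e>0$. Equip $\Gamma$ with the shortest-path distance $\operatorname{dist}$ and with the measure $\mathrm dx$ given by Lebesgue measure on each edge, and assume that its total length $L=|\Gamma|:=\sum_{e\in E}\ell_e$ satisfies $L>0$. Let $$\rho(\Gamma):=\frac1{L^2}\int_\Gamma\int_\Gamma \operatorname{dist}(x,y)\,\mathrm dy\,\mathrm dx$$ be the mean distance of $\Gamma$, and let $$\mu_2(\Gamma):=\inf\left\{\frac{\int_\Gamma |u'(x)|^2\,\mathrm dx}{\int_\Gamma |u(x)|^2\,\mathrm dx} : 0\neq u\in H^1(\Gamma),\ \int_\Gamma u(x)\,\mathrm dx=0\right\}$$ be the spectral gap of the Laplacian on $\Gamma$ with standard vertex conditions, where $H^1(\Gamma)$ is the space of continuous, square integrable, real-valued functions on $\Gamma$ whose weak derivative on the edges is square integrable. Then $$\frac1L\le \mu_2(\Gamma)\,\rho(\Gamma).$$ -/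

import Mathlib

open MeasureTheory Set
open scoped ContDiff

/-- A connected metric graph with vertex set `V` and edge set `E`. Each edge `e` is identified with
the interval `[0, len e]`, the point `0` being glued to the vertex `src e` and the point `len e` to
the vertex `tgt e`. Loops and multiple edges are allowed. The graph is compact when `V` and `E` are
finite. -/
structure MetricGraph (V E : Type*) where
  src : E → V
  tgt : E → V
  len : E → ℝ
  len_pos : ∀ e, 0 < len e
  nonempty : Nonempty V
  connected : ∀ v w : V, Relation.EqvGen (fun a b => ∃ e, src e = a ∧ tgt e = b) v w

namespace MetricGraph

variable {V E : Type*} (Γ : MetricGraph V E)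

/-- Disjoint union of the vertices and of the closed edges, before gluing. -/
abbrev PrePoint : Type _ := V ⊕ (Σ e : E, Icc (0 : ℝ) (Γ.len e))

/-- The initial point of an edge. -/
def start (e : E) : Icc (0 : ℝ) (Γ.len e) := ⟨0, le_rfl, (Γ.len_pos e).le⟩

/-- The final point of an edge. -/
def finish (e : E) : Icc (0 : ℝ) (Γ.len e) := ⟨Γ.len e, (Γ.len_pos e).le, le_rfl⟩

/-- The two ends of every edge are glued to the corresponding vertices. -/
inductive Glue : Γ.PrePoint → Γ.PrePoint → Prop
  | src (e : E) : Glue (Sum.inr ⟨e, Γ.start e⟩) (Sum.inl (Γ.src e))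
  | tgt (e : E) : Glue (Sum.inr ⟨e, Γ.finish e⟩) (Sum.inl (Γ.tgt e))

/-- The points of the metric graph: the quotient by the equivalence relation generated by
the gluing. -/
def Point : Type _ := Quot Γ.Glue

/-- A vertex as a point of the metric graph. -/
def vertex (v : V) : Γ.Point := Quot.mk _ (Sum.inl v)

/-- The parametrisation of an edge by `[0, len e]`. -/
def edge (e : E) (t : Icc (0 : ℝ) (Γ.len e)) : Γ.Point := Quot.mk _ (Sum.inr ⟨e, t⟩)

/-- `Γ.HasPath x y r`: some path from `x` to `y`, a concatenation of finitely many segments each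
running inside one closed edge, has length `r`. -/
inductive HasPath : Γ.Point → Γ.Point → ℝ → Prop
  | nil (x : Γ.Point) : HasPath x x 0
  | cons (e : E) (s t : Icc (0 : ℝ) (Γ.len e)) (y : Γ.Point) (r : ℝ)
      (h : HasPath (Γ.edge e t) y r) : HasPath (Γ.edge e s) y (|(s : ℝ) - t| + r)

/-- The shortest-path distance. -/
noncomputable def pathDist (x y : Γ.Point) : ℝ := sInf {r : ℝ | Γ.HasPath x y r}

variable {Γ}

theorem edge_start (e : E) : Γ.edge e (Γ.start e) = Γ.vertex (Γ.src e) := Quot.sound (.src e)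

theorem edge_finish (e : E) : Γ.edge e (Γ.finish e) = Γ.vertex (Γ.tgt e) := Quot.sound (.tgt e)

theorem HasPath.nonneg {x y : Γ.Point} {r : ℝ} (h : Γ.HasPath x y r) : 0 ≤ r := by
  induction h with
  | nil => exact le_rfl
  | cons e s t y r _ ih => positivity

theorem HasPath.trans {x y z : Γ.Point} {r q : ℝ} (h : Γ.HasPath x y r) (h' : Γ.HasPath y z q) :
    Γ.HasPath x z (r + q) := by
  induction h with
  | nil => simpa using h'
  | cons e s t y r _ ih => rw [add_assoc]; exact .cons e s t z _ (ih h')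

theorem hasPath_edge (e : E) (s t : Icc (0 : ℝ) (Γ.len e)) :
    Γ.HasPath (Γ.edge e s) (Γ.edge e t) |(s : ℝ) - t| := by
  simpa using HasPath.cons e s t _ 0 (.nil (Γ.edge e t))

theorem HasPath.symm {x y : Γ.Point} {r : ℝ} (h : Γ.HasPath x y r) : Γ.HasPath y x r := by
  induction h with
  | nil => exact .nil _
  | cons e s t y r _ ih =>
    rw [add_comm, abs_sub_comm]
    exact ih.trans (hasPath_edge e t s)

theorem exists_hasPath_vertex (v w : V) : ∃ r, Γ.HasPath (Γ.vertex v) (Γ.vertex w) r := by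
  induction Γ.connected v w with
  | rel a b h =>
    obtain ⟨e, rfl, rfl⟩ := h
    rw [← edge_start, ← edge_finish]
    exact ⟨_, hasPath_edge e _ _⟩
  | refl a => exact ⟨0, .nil _⟩
  | symm a b _ ih => exact ih.imp fun _ h => h.symm
  | trans a b c _ _ h h' =>
    obtain ⟨r, h⟩ := h
    obtain ⟨q, h'⟩ := h'
    exact ⟨_, h.trans h'⟩

theorem exists_hasPath_to_vertex (x : Γ.Point) : ∃ v r, Γ.HasPath x (Γ.vertex v) r := by
  induction x using Quot.ind with
  | mk p =>
    rcases p with v | ⟨e, t⟩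
    · exact ⟨v, 0, .nil _⟩
    · exact ⟨Γ.src e, _, edge_start (Γ := Γ) e ▸ hasPath_edge e t (Γ.start e)⟩

theorem exists_hasPath (x y : Γ.Point) : ∃ r, Γ.HasPath x y r := by
  obtain ⟨v, r, h⟩ := exists_hasPath_to_vertex x
  obtain ⟨w, q, h'⟩ := exists_hasPath_to_vertex y
  obtain ⟨p, k⟩ := exists_hasPath_vertex (Γ := Γ) v w
  exact ⟨_, (h.trans k).trans h'.symm⟩

theorem pathDist_le {x y : Γ.Point} {r : ℝ} (h : Γ.HasPath x y r) : Γ.pathDist x y ≤ r :=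
  csInf_le ⟨0, fun _ hq => HasPath.nonneg hq⟩ h

variable (Γ)

/-- A metric graph is a (pseudo)metric space with the shortest-path distance; its topology, and
hence the notion of continuity, is the one of this distance. -/
noncomputable instance : PseudoMetricSpace Γ.Point where
  dist := Γ.pathDist
  dist_self x :=
    le_antisymm (pathDist_le (.nil x)) (Real.sInf_nonneg fun _ h => HasPath.nonneg h)
  dist_comm x y := by
    have h : {r : ℝ | Γ.HasPath x y r} = {r : ℝ | Γ.HasPath y x r} :=
      Set.ext fun _ => ⟨HasPath.symm, HasPath.symm⟩
    exact congrArg sInf h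
  dist_triangle x y z := by
    refine le_of_forall_pos_lt_add fun ε hε => ?_
    obtain ⟨r, hr, hr'⟩ := Real.lt_sInf_add_pos (s := {r : ℝ | Γ.HasPath x y r})
      (exists_hasPath x y) (half_pos hε)
    obtain ⟨q, hq, hq'⟩ := Real.lt_sInf_add_pos (s := {r : ℝ | Γ.HasPath y z r})
      (exists_hasPath y z) (half_pos hε)
    have h := pathDist_le (HasPath.trans hr hq)
    change Γ.pathDist x z < Γ.pathDist x y + Γ.pathDist y z + ε
    unfold pathDist at h ⊢
    linarith

noncomputable instance : MeasurableSpace Γ.Point := borel Γ.Point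

instance : BorelSpace Γ.Point := ⟨rfl⟩

/-- The edge parametrisations are continuous, hence measurable. -/
theorem continuous_edge (e : E) : Continuous (Γ.edge e) :=
  (LipschitzWith.of_dist_le' (K := 1) fun s t => by
    rw [one_mul]; exact pathDist_le (hasPath_edge e s t)).continuous

/-- Lebesgue measure on the interval `[0, len e]`. -/
noncomputable def edgeMeasure (e : E) : Measure (Icc (0 : ℝ) (Γ.len e)) :=
  (volume : Measure ℝ).comap Subtype.val

/-- `g` is the weak derivative of `u` on the interior of every edge (with respect to the given
parametrisations). -/
def HasWeakDeriv (u g : Γ.Point → ℝ) : Prop :=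
  ∀ e : E, ∀ φ : ℝ → ℝ, ContDiff ℝ ∞ φ → HasCompactSupport φ → tsupport φ ⊆ Ioo 0 (Γ.len e) →
    ∫ t : Icc (0 : ℝ) (Γ.len e), u (Γ.edge e t) * deriv φ t ∂Γ.edgeMeasure e =
      -∫ t : Icc (0 : ℝ) (Γ.len e), g (Γ.edge e t) * φ t ∂Γ.edgeMeasure e

variable [Fintype E]

/-- The measure `dx` on the metric graph: the sum of the Lebesgue measures on the edges. -/
noncomputable def measure : Measure Γ.Point := ∑ e : E, (Γ.edgeMeasure e).map (Γ.edge e)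

/-- The total length `|Γ|`. -/
def totalLength : ℝ := ∑ e : E, Γ.len e

/-- The mean distance from the point `x`. -/
noncomputable def meanDistanceFrom (x : Γ.Point) : ℝ :=
  1 / Γ.totalLength * ∫ y : Γ.Point, dist x y ∂Γ.measure

/-- The mean distance `ρ(Γ)`. -/
noncomputable def meanDistance : ℝ :=
  1 / Γ.totalLength * ∫ x : Γ.Point, Γ.meanDistanceFrom x ∂Γ.measure

/-- `u ∈ H¹(Γ)`, with derivative `u' = g` (which is unique up to null sets): `u` is continuous and
square integrable, and has the square integrable weak derivative `g`. -/
def IsH1 (u g : Γ.Point → ℝ) : Prop :=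
  Continuous u ∧ MemLp u 2 Γ.measure ∧
    Γ.HasWeakDeriv u g ∧ MemLp g 2 Γ.measure

/-- The spectral gap `μ₂(Γ)` of the Laplacian with standard vertex conditions: the infimum of the
Rayleigh quotients of the nonzero functions in `H¹(Γ)` with mean value zero. -/
noncomputable def spectralGap : ℝ :=
  sInf {q : ℝ | ∃ u g : Γ.Point → ℝ, Γ.IsH1 u g ∧ u ≠ 0 ∧ ∫ x, u x ∂Γ.measure = 0 ∧
    q = (∫ x, g x ^ 2 ∂Γ.measure) / ∫ x, u x ^ 2 ∂Γ.measure}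

end MetricGraph

/-!
The spectral gap is bounded from below by comparing increments of `u` with distances. Expanding the
square gives `∫∫ (u x - u y)² dy dx = 2 L ∫ u²` for `u` of mean value zero, so the pointwise bound

  `(u x - u y)² ≤ dist x y * ∫ |u'|²`

integrates to `2 ∫ u² ≤ L ρ ∫ |u'|²`, twice as much as is needed
(`MetricGraph.IsH1.two_mul_integral_sq_le`).

The pointwise bound says that the effective resistance between two points is at most their distance.
Applying the Cauchy–Schwarz inequality along a path from `x` to `y` gives it only if the path does
not run through the same segment repeatedly. Instead of making paths simple, the proof
(`MetricGraph.HasPath.sq_sub_le`) shows that the effective resistance satisfies the triangle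
inequality: at an intermediate point where `u` takes the value `m`, the truncations `min u m` and
`max u m` have disjointly supported derivatives, so that their energies add up to at most that of
`u`, and the bounds for the two parts of the path combine by Cauchy–Schwarz.

In order to truncate without differentiating, the energy of `u` is recorded by measures `ν` on the
edges with `(u t - u s)² ≤ (t - s) ν (s, t)` (`MetricGraph.IsEnergyBound`). For an `H¹` function
this holds with `ν = |u'|² dx`, since a continuous function with an integrable weak derivative is the
integral of this derivative (`sub_eq_integral_of_weakDeriv`, from the du Bois-Reymond lemma).

Lastly, the infimum of a set of reals bounds nothing if the set is empty, and a quotient by zero is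
zero. Hence one shows that the set of Rayleigh quotients is nonempty
(`MetricGraph.exists_isH1_ne_zero_integral_eq_zero`), and that their denominators are positive
(`MetricGraph.integral_sq_pos`).
-/

/-! ### Weak derivatives on an interval -/

theorem IsCompact.exists_subset_Icc_of_subset_Ioo {a b : ℝ} (hab : a < b) {K : Set ℝ}
    (hK : IsCompact K) (h : K ⊆ Ioo a b) : ∃ a' b', a < a' ∧ b' < b ∧ K ⊆ Icc a' b' := by
  rcases K.eq_empty_or_nonempty with rfl | hne
  · exact ⟨b, a, hab, hab, empty_subset _⟩
  · obtain ⟨x, hx⟩ := hK.exists_isLeast hne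
    obtain ⟨y, hy⟩ := hK.exists_isGreatest hne
    exact ⟨x, y, (h hx.1).1, (h hy.1).2, fun z hz => ⟨hx.2 hz, hy.2 hz⟩⟩

/-- A test function of vanishing integral is the derivative of a test function. -/
theorem exists_deriv_eq_of_integral_eq_zero {a b : ℝ} (hab : a < b) {ψ : ℝ → ℝ}
    (hψ : ContDiff ℝ ∞ ψ) (hc : HasCompactSupport ψ) (hs : tsupport ψ ⊆ Ioo a b)
    (h0 : ∫ x in a..b, ψ x = 0) :
    ∃ φ : ℝ → ℝ, ContDiff ℝ ∞ φ ∧ HasCompactSupport φ ∧ tsupport φ ⊆ Ioo a b ∧ deriv φ = ψ := by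
  obtain ⟨a', b', ha, hb, hK⟩ := hc.isCompact.exists_subset_Icc_of_subset_Ioo hab hs
  have hder : deriv (fun x => ∫ t in a..x, ψ t) = ψ :=
    funext fun x => hψ.continuous.deriv_integral ψ a x
  have hzero : ∀ x, x ∉ Icc a' b' → ψ x = 0 := fun x hx => image_eq_zero_of_notMem_tsupport
    fun h => hx (hK h)
  have hsupp : Function.support (fun x => ∫ t in a..x, ψ t) ⊆ Icc a' b' := by
    intro x hx
    by_contra hx'
    apply hx
    rw [mem_Icc, not_and_or, not_le, not_le] at hx'
    rcases hx' with hx' | hx'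
    · refine intervalIntegral.integral_zero_ae (Filter.Eventually.of_forall fun t ht => hzero t ?_)
      rw [mem_uIoc] at ht
      rintro ⟨h1, -⟩
      rcases ht with ht | ht <;> linarith [ht.1, ht.2]
    · have hi := fun p q => hψ.continuous.intervalIntegrable (μ := volume) p q
      have : ∫ t in b..x, ψ t = 0 := by
        refine intervalIntegral.integral_zero_ae
          (Filter.Eventually.of_forall fun t ht => hzero t ?_)
        rw [mem_uIoc] at ht
        rintro ⟨-, h1⟩
        rcases ht with ht | ht <;> linarith [ht.1, ht.2]
      change ∫ t in a..x, ψ t = 0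
      rw [← intervalIntegral.integral_add_adjacent_intervals (hi a b) (hi b x), h0, this, add_zero]
  have hts : tsupport (fun x => ∫ t in a..x, ψ t) ⊆ Icc a' b' :=
    closure_minimal hsupp isClosed_Icc
  refine ⟨fun x => ∫ t in a..x, ψ t, ?_, ?_, ?_, hder⟩
  · rw [contDiff_infty_iff_deriv]
    refine ⟨fun x => ?_, by rw [hder]; exact hψ⟩
    exact (intervalIntegral.integral_hasDerivAt_right (hψ.continuous.intervalIntegrable _ _)
      (hψ.continuous.stronglyMeasurableAtFilter _ _) hψ.continuous.continuousAt).differentiableAt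
  · exact HasCompactSupport.of_support_subset_isCompact isCompact_Icc hsupp
  · exact hts.trans fun x hx => ⟨ha.trans_le hx.1, hx.2.trans_lt hb⟩

theorem exists_testFunction_integral_eq_one {a b : ℝ} (hab : a < b) :
    ∃ ψ : ℝ → ℝ, ContDiff ℝ ∞ ψ ∧ HasCompactSupport ψ ∧ tsupport ψ ⊆ Ioo a b ∧
      ∫ x in a..b, ψ x = 1 := by
  let f : ContDiffBump ((a + b) / 2) := ⟨(b - a) / 8, (b - a) / 4, by linarith, by linarith⟩
  have hts : tsupport (f.normed volume) ⊆ Ioo a b := by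
    rw [f.tsupport_normed_eq, Real.closedBall_eq_Icc]
    intro x hx
    have h1 := hx.1
    have h2 := hx.2
    simp only [f] at h1 h2
    constructor <;> linarith
  refine ⟨f.normed volume, f.contDiff_normed, f.hasCompactSupport_normed, hts, ?_⟩
  rw [intervalIntegral.integral_of_le hab.le, setIntegral_eq_integral_of_forall_compl_eq_zero,
    f.integral_normed]
  intro x hx
  exact image_eq_zero_of_notMem_tsupport fun h => hx (Ioo_subset_Ioc_self (hts h))

/-- **Du Bois-Reymond lemma**: a continuous function with vanishing weak derivative on an interval
is constant. -/
theorem eq_of_integral_mul_deriv_eq_zero {a b : ℝ} (hab : a < b) {w : ℝ → ℝ}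
    (hw : ContinuousOn w (Icc a b))
    (h : ∀ φ : ℝ → ℝ, ContDiff ℝ ∞ φ → HasCompactSupport φ → tsupport φ ⊆ Ioo a b →
      ∫ x in a..b, w x * deriv φ x = 0) :
    ∃ c, ∀ x ∈ Icc a b, w x = c := by
  obtain ⟨ψ, hψ, hψc, hψs, hψ1⟩ := exists_testFunction_integral_eq_one hab
  have hwi : ∀ η : ℝ → ℝ, ContDiff ℝ ∞ η → IntervalIntegrable (fun x => w x * η x) volume a b :=
    fun η hη => (hw.mul hη.continuous.continuousOn).intervalIntegrable_of_Icc hab.le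
  set c := ∫ x in a..b, w x * ψ x with hc
  have hae : ∀ᵐ x, x ∈ Ioo a b → w x - c = 0 := by
    refine isOpen_Ioo.ae_eq_zero_of_integral_contDiff_smul_eq_zero ?_ fun η hη hηc hηs => ?_
    · exact ((hw.mono Ioo_subset_Icc_self).sub continuousOn_const).locallyIntegrableOn
        measurableSet_Ioo
    · -- Subtracting the multiple `m ψ` of a fixed test function of integral one turns `η` into the
      -- derivative of a test function.
      have hηi := hη.continuous.intervalIntegrable (μ := volume) a b
      have hψi := hψ.continuous.intervalIntegrable (μ := volume) a b
      set m := ∫ x in a..b, η x with hm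
      have hsm : ContDiff ℝ ∞ (fun x => m * ψ x) := contDiff_const.mul hψ
      obtain ⟨φ, h1, h2, h3, h4⟩ := exists_deriv_eq_of_integral_eq_zero hab
        (ψ := fun x => η x - m * ψ x) (hη.sub hsm) (hηc.sub hψc.mul_left)
        ((tsupport_sub _ _).trans (union_subset hηs ((tsupport_mul_subset_right).trans hψs)))
        (by rw [intervalIntegral.integral_sub hηi (hψi.const_mul m),
              intervalIntegral.integral_const_mul, hψ1, mul_one, sub_self])
      have h5 := h φ h1 h2 h3
      rw [h4] at h5
      have h6 : ∫ x in a..b, w x * (η x - m * ψ x) = (∫ x in a..b, w x * η x) - m * c := by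
        rw [hc, ← intervalIntegral.integral_const_mul, ← intervalIntegral.integral_sub (hwi η hη)
          ((hwi ψ hψ).const_mul m)]
        congr 1; ext x; ring
      have h7 : ∫ x, η x • (w x - c) = ∫ x in a..b, η x • (w x - c) := by
        rw [intervalIntegral.integral_of_le hab.le,
          setIntegral_eq_integral_of_forall_compl_eq_zero]
        intro x hx
        rw [image_eq_zero_of_notMem_tsupport fun h => hx (Ioo_subset_Ioc_self (hηs h)), zero_smul]
      have h8 : ∫ x in a..b, η x • (w x - c) = (∫ x in a..b, w x * η x) - c * m := by
        rw [hm, ← intervalIntegral.integral_const_mul, ← intervalIntegral.integral_sub (hwi η hη)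
          (hηi.const_mul c)]
        congr 1; ext x; rw [smul_eq_mul]; ring
      rw [h7, h8]
      linarith
  have heq : EqOn w (fun _ => c) (Ioo a b) := by
    refine Measure.eqOn_open_of_ae_eq (μ := volume) ?_ isOpen_Ioo (hw.mono Ioo_subset_Icc_self)
      continuousOn_const
    rw [Filter.EventuallyEq, ae_restrict_iff' measurableSet_Ioo]
    filter_upwards [hae] with x hx hx'
    linarith [hx hx']
  refine ⟨c, heq.of_subset_closure hw continuousOn_const Ioo_subset_Icc_self ?_⟩
  rw [closure_Ioo hab.ne]

/-- A continuous function with an integrable weak derivative is its integral: subtracting the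
integral leaves a function with vanishing weak derivative. -/
theorem sub_eq_integral_of_weakDeriv {a b : ℝ} (hab : a < b) {u g : ℝ → ℝ}
    (hu : ContinuousOn u (Icc a b)) (hg : IntervalIntegrable g volume a b)
    (h : ∀ φ : ℝ → ℝ, ContDiff ℝ ∞ φ → HasCompactSupport φ → tsupport φ ⊆ Ioo a b →
      ∫ x in a..b, u x * deriv φ x = -∫ x in a..b, g x * φ x)
    {s t : ℝ} (hs : s ∈ Icc a b) (ht : t ∈ Icc a b) : u t - u s = ∫ x in s..t, g x := by
  have hI : ∀ p ∈ Icc a b, ∀ q ∈ Icc a b, IntervalIntegrable g volume p q := fun p hp q hq =>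
    hg.mono_set (by rw [uIcc_of_le hab.le]; exact ordConnected_Icc.uIcc_subset hp hq)
  have ha : a ∈ Icc a b := left_mem_Icc.2 hab.le
  have hG := hg.absolutelyContinuousOnInterval_intervalIntegral (c := a) left_mem_uIcc
  have hGc : ContinuousOn (fun x => ∫ v in a..x, g v) (Icc a b) := by
    simpa only [uIcc_of_le hab.le] using hG.continuousOn
  obtain ⟨c, hc⟩ := eq_of_integral_mul_deriv_eq_zero (w := fun x => u x - ∫ v in a..x, g v) hab
    (hu.sub hGc) fun φ h1 h2 h3 => by
    have hφa : φ a = 0 := image_eq_zero_of_notMem_tsupport fun h => (h3 h).1.ne rfl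
    have hφb : φ b = 0 := image_eq_zero_of_notMem_tsupport fun h => (h3 h).2.ne rfl
    have hφ' : Continuous (deriv φ) := h1.continuous_deriv (by simp)
    have hφ : AbsolutelyContinuousOnInterval φ a b :=
      ((h1.of_le (m := 1) (by simp)).contDiffOn).absolutelyContinuousOnInterval
    have hp := hG.integral_mul_deriv_eq_deriv_mul hφ
    have hd : ∫ x in a..b, deriv (fun x => ∫ v in a..x, g v) x * φ x = ∫ x in a..b, g x * φ x := by
      refine intervalIntegral.integral_congr_ae ?_
      filter_upwards [hg.ae_hasDerivAt_integral] with x hx hx'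
      rw [(hx (uIoc_subset_uIcc hx') a left_mem_uIcc).deriv]
    rw [hφa, hφb, hd] at hp
    have e : (fun x => (u x - ∫ v in a..x, g v) * deriv φ x) =
        fun x => u x * deriv φ x - (∫ v in a..x, g v) * deriv φ x := by ext; ring
    have i1 : IntervalIntegrable (fun x => u x * deriv φ x) volume a b :=
      (hu.mul hφ'.continuousOn).intervalIntegrable_of_Icc hab.le
    have i2 : IntervalIntegrable (fun x => (∫ v in a..x, g v) * deriv φ x) volume a b :=
      (hGc.mul hφ'.continuousOn).intervalIntegrable_of_Icc hab.le
    rw [e, intervalIntegral.integral_sub i1 i2, hp, h φ h1 h2 h3]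
    ring
  have h1 : u s - ∫ v in a..s, g v = c := hc s hs
  have h2 : u t - ∫ v in a..t, g v = c := hc t ht
  have h3 := intervalIntegral.integral_add_adjacent_intervals (hI a ha s hs) (hI s hs t ht)
  linarith

/-- Cauchy–Schwarz inequality, from expanding `∫ ((t - s) g - ∫ g)² ≥ 0`. -/
theorem sq_intervalIntegral_le {s t : ℝ} (hst : s ≤ t) {g : ℝ → ℝ}
    (hg : IntervalIntegrable g volume s t)
    (hg2 : IntervalIntegrable (fun x => g x ^ 2) volume s t) :
    (∫ x in s..t, g x) ^ 2 ≤ (t - s) * ∫ x in s..t, g x ^ 2 := by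
  rcases hst.eq_or_lt with rfl | hlt
  · simp
  set I := ∫ x in s..t, g x with hI
  set J := ∫ x in s..t, g x ^ 2 with hJ
  have h0 : 0 ≤ ∫ x in s..t, ((t - s) * g x - I) ^ 2 :=
    intervalIntegral.integral_nonneg hst fun x _ => sq_nonneg _
  have h1 : ∫ x in s..t, ((t - s) * g x - I) ^ 2 = (t - s) * ((t - s) * J - I ^ 2) := by
    have e : (fun x => ((t - s) * g x - I) ^ 2) =
        fun x => (t - s) ^ 2 * g x ^ 2 - 2 * (t - s) * I * g x + I ^ 2 := by ext; ring
    rw [e, intervalIntegral.integral_add ((hg2.const_mul _).sub (hg.const_mul _))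
      intervalIntegrable_const, intervalIntegral.integral_sub (hg2.const_mul _) (hg.const_mul _),
      intervalIntegral.integral_const_mul, intervalIntegral.integral_const_mul,
      intervalIntegral.integral_const, ← hI, ← hJ, smul_eq_mul]
    ring
  rw [h1] at h0
  linarith [nonneg_of_mul_nonneg_right h0 (sub_pos.2 hlt)]

/-! ### Energy bounds and effective resistance -/

namespace MetricGraph

variable {V E : Type*} {Γ : MetricGraph V E}

/-- `u` has energy at most `ν`: the increment of `u` over any segment of an edge satisfies the
Cauchy–Schwarz estimate with respect to `ν`. For an `H¹` function with derivative `g` this holds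
with `ν = g² dx`. The measures are attached to the closed edges, before gluing. -/
def IsEnergyBound (u : Γ.Point → ℝ) (ν : ∀ e : E, Measure (Icc (0 : ℝ) (Γ.len e))) : Prop :=
  ∀ (e : E) (s t : Icc (0 : ℝ) (Γ.len e)), s ≤ t →
    (u (Γ.edge e t) - u (Γ.edge e s)) ^ 2 ≤ (t - s : ℝ) * (ν e).real (Ioo s t)

theorem IsEnergyBound.neg {u : Γ.Point → ℝ} {ν : ∀ e : E, Measure (Icc (0 : ℝ) (Γ.len e))}
    (h : Γ.IsEnergyBound u ν) : Γ.IsEnergyBound (fun x => -u x) ν := fun e s t hst => by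
  have := h e s t hst
  rwa [neg_sub_neg, ← neg_sub, neg_sq]

/-- Truncation from below is local: the energy of `max u c` is carried by `{u > c}`. If `max u c`
increases between `s` and `t`, then `u > c` holds after the last point at which `u` is at most
`max (u s) c`, and the increment after this point is at least as large. -/
theorem IsEnergyBound.max_const {u : Γ.Point → ℝ}
    {ν : ∀ e : E, Measure (Icc (0 : ℝ) (Γ.len e))} [∀ e, IsFiniteMeasure (ν e)]
    (hu : Continuous u) (h : Γ.IsEnergyBound u ν) (c : ℝ) :
    Γ.IsEnergyBound (fun x => max (u x) c)
      (fun e => (ν e).restrict {t | c < u (Γ.edge e t)}) := by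
  intro e s t hst
  have hf : Continuous fun t => u (Γ.edge e t) := hu.comp (Γ.continuous_edge e)
  have hst' : (s : ℝ) ≤ t := hst
  rw [measureReal_restrict_apply measurableSet_Ioo]
  -- It suffices to find a subsegment `[p, q]` with `u > c` inside on which the increment of `u` is
  -- at least that of `max u c` on `[s, t]`.
  have key : ∀ p q : Icc (0 : ℝ) (Γ.len e), s ≤ p → p ≤ q → q ≤ t →
      (∀ x ∈ Ioo p q, c < u (Γ.edge e x)) →
      (u (Γ.edge e q) - u (Γ.edge e p)) ^ 2 ≤
        (t - s : ℝ) * (ν e).real (Ioo s t ∩ {t | c < u (Γ.edge e t)}) := by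
    intro p q hsp hpq hqt hx
    have h1 : (s : ℝ) ≤ p := hsp
    have h2 : (q : ℝ) ≤ t := hqt
    refine (h e p q hpq).trans (mul_le_mul (by linarith) (measureReal_mono ?_)
      measureReal_nonneg (by linarith))
    exact fun x hx' => ⟨⟨hsp.trans_lt hx'.1, hx'.2.trans_le hqt⟩, hx x hx'⟩
  rcases lt_trichotomy (max (u (Γ.edge e s)) c) (max (u (Γ.edge e t)) c) with hlt | heq | hgt
  · have hm : max (u (Γ.edge e s)) c < u (Γ.edge e t) := by
      rcases lt_max_iff.1 hlt with h' | h'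
      · exact h'
      · exact absurd h' (not_lt.2 (le_max_right _ _))
    obtain ⟨p, ⟨⟨hp1, hp2⟩, hp3⟩, hpmax⟩ := ((isClosed_Icc (a := s) (b := t)).isCompact.inter_right
      (isClosed_le hf (continuous_const (y := max (u (Γ.edge e s)) c)))).exists_isGreatest
      ⟨s, left_mem_Icc.2 hst, by simp⟩
    have hp3' : u (Γ.edge e p) ≤ max (u (Γ.edge e s)) c := hp3
    refine le_trans ?_ (key p t hp1 hp2 le_rfl fun x hx => ?_)
    · have : max (u (Γ.edge e t)) c = u (Γ.edge e t) :=
        max_eq_left ((le_max_right _ _).trans hm.le)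
      simp only [this]
      gcongr
    · by_contra hcx
      exact absurd (hpmax ⟨⟨hp1.trans hx.1.le, hx.2.le⟩,
        (not_lt.1 hcx).trans (le_max_right _ _)⟩) (not_le.2 hx.1)
  · simp only [heq, sub_self]
    rw [zero_pow two_ne_zero]
    exact mul_nonneg (by linarith) measureReal_nonneg
  · have hm : max (u (Γ.edge e t)) c < u (Γ.edge e s) := by
      rcases lt_max_iff.1 hgt with h' | h'
      · exact h'
      · exact absurd h' (not_lt.2 (le_max_right _ _))
    obtain ⟨p, ⟨⟨hp1, hp2⟩, hp3⟩, hpmin⟩ := ((isClosed_Icc (a := s) (b := t)).isCompact.inter_right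
      (isClosed_le hf (continuous_const (y := max (u (Γ.edge e t)) c)))).exists_isLeast
      ⟨t, right_mem_Icc.2 hst, by simp⟩
    have hp3' : u (Γ.edge e p) ≤ max (u (Γ.edge e t)) c := hp3
    refine le_trans ?_ (key s p le_rfl hp1 hp2 fun x hx => ?_)
    · have : max (u (Γ.edge e s)) c = u (Γ.edge e s) :=
        max_eq_left ((le_max_right _ _).trans hm.le)
      simp only [this]
      rw [← neg_sub, neg_sq, ← neg_sub (u (Γ.edge e s)), neg_sq]
      gcongr
    · by_contra hcx
      exact absurd (hpmin ⟨⟨hx.1.le, hx.2.le.trans hp2⟩,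
        (not_lt.1 hcx).trans (le_max_right _ _)⟩) (not_le.2 hx.2)

theorem IsEnergyBound.min_const {u : Γ.Point → ℝ}
    {ν : ∀ e : E, Measure (Icc (0 : ℝ) (Γ.len e))} [∀ e, IsFiniteMeasure (ν e)]
    (hu : Continuous u) (h : Γ.IsEnergyBound u ν) (c : ℝ) :
    Γ.IsEnergyBound (fun x => min (u x) c)
      (fun e => (ν e).restrict {t | u (Γ.edge e t) < c}) := by
  have := (h.neg.max_const (u := fun x => -u x) hu.neg (-c)).neg
  simpa only [max_neg_neg, neg_neg, neg_lt_neg_iff] using this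

variable [Fintype E]

/-- The total energy splits at every level `c`. -/
theorem sum_restrict_lt_add_sum_restrict_gt_le {u : Γ.Point → ℝ}
    (ν : ∀ e : E, Measure (Icc (0 : ℝ) (Γ.len e))) [∀ e, IsFiniteMeasure (ν e)]
    (hu : Continuous u) (c : ℝ) :
    (∑ e, ((ν e).restrict {t | u (Γ.edge e t) < c}).real univ) +
      ∑ e, ((ν e).restrict {t | c < u (Γ.edge e t)}).real univ ≤ ∑ e, (ν e).real univ := by
  rw [← Finset.sum_add_distrib]
  refine Finset.sum_le_sum fun e _ => ?_
  have hf : Continuous fun t => u (Γ.edge e t) := hu.comp (Γ.continuous_edge e)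
  rw [measureReal_restrict_apply_univ, measureReal_restrict_apply_univ, ← measureReal_union]
  · exact measureReal_mono (subset_univ _)
  · exact disjoint_left.2 fun t h1 h2 => lt_asymm (mem_ofPred_eq ▸ h1) h2
  · exact (isOpen_lt continuous_const hf).measurableSet

/-- **Effective resistance is at most path length.** The increment of `u` between the ends of a
path of length `r` is controlled by `r` times the total energy of `u`, however often the path runs
through the same edge. The induction step is the triangle inequality for the effective resistance:
if the value `m` of `u` at the intermediate point lies between the end values, then the
truncations `min u m` and `max u m` share the energy of `u`. -/
theorem HasPath.sq_sub_le {x y : Γ.Point} {r : ℝ} (hr : Γ.HasPath x y r) {u : Γ.Point → ℝ}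
    {ν : ∀ e : E, Measure (Icc (0 : ℝ) (Γ.len e))} [∀ e, IsFiniteMeasure (ν e)]
    (hu : Continuous u) (h : Γ.IsEnergyBound u ν) :
    (u y - u x) ^ 2 ≤ r * ∑ e, (ν e).real univ := by
  induction hr generalizing u ν with
  | nil x => simp
  | cons e s t y r hr ih =>
    have hr0 := hr.nonneg
    have seg : ∀ {u : Γ.Point → ℝ} {ν : ∀ e : E, Measure (Icc (0 : ℝ) (Γ.len e))}
        [∀ e, IsFiniteMeasure (ν e)], Γ.IsEnergyBound u ν →
        (u (Γ.edge e t) - u (Γ.edge e s)) ^ 2 ≤ |(s : ℝ) - t| * ∑ e, (ν e).real univ := by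
      intro u ν _ h
      have hle : ∀ S, (ν e).real S ≤ ∑ e, (ν e).real univ := fun S =>
        (measureReal_mono (subset_univ S)).trans
          (Finset.single_le_sum (f := fun e => (ν e).real univ)
            (fun e _ => measureReal_nonneg) (Finset.mem_univ e))
      rcases le_total s t with hst | hst
      · have hst' : (s : ℝ) ≤ t := hst
        rw [abs_of_nonpos (by linarith), neg_sub]
        exact (h e s t hst).trans (mul_le_mul_of_nonneg_left (hle _) (by linarith))
      · have hst' : (t : ℝ) ≤ s := hst
        rw [abs_of_nonneg (by linarith), ← neg_sub, neg_sq]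
        exact (h e t s hst).trans (mul_le_mul_of_nonneg_left (hle _) (by linarith))
    -- The case in which `u` does not decrease along the path; the other one is symmetric.
    have main : ∀ {u : Γ.Point → ℝ}, Continuous u → Γ.IsEnergyBound u ν →
        u (Γ.edge e s) ≤ u y →
        (u y - u (Γ.edge e s)) ^ 2 ≤ (|(s : ℝ) - t| + r) * ∑ e, (ν e).real univ := by
      intro u hu h hle
      set a := |(s : ℝ) - t|
      have ha : 0 ≤ a := abs_nonneg _
      set p := u (Γ.edge e s) with hp
      set m := u (Γ.edge e t) with hm
      set q := u y with hq
      have hT : 0 ≤ ∑ e, (ν e).real univ := Finset.sum_nonneg fun e _ => measureReal_nonneg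
      rcases lt_or_ge m p with hmp | hpm
      · have h1 := ih hu h
        have h2 : (q - p) ^ 2 ≤ (q - m) ^ 2 := by gcongr
        nlinarith [mul_nonneg ha hT]
      rcases lt_or_ge q m with hqm | hmq
      · have h1 := seg h
        have h2 : (q - p) ^ 2 ≤ (m - p) ^ 2 := by gcongr
        nlinarith [mul_nonneg hr0 hT]
      have h1 := seg (h.min_const hu m)
      have h2 := ih (hu.max continuous_const) (h.max_const hu m)
      have h3 := sum_restrict_lt_add_sum_restrict_gt_le ν hu m
      set E1 := ∑ e, ((ν e).restrict {t | u (Γ.edge e t) < m}).real univ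
      set E2 := ∑ e, ((ν e).restrict {t | m < u (Γ.edge e t)}).real univ
      have hE1 : 0 ≤ E1 := Finset.sum_nonneg fun e _ => measureReal_nonneg
      have hE2 : 0 ≤ E2 := Finset.sum_nonneg fun e _ => measureReal_nonneg
      simp only [← hp, ← hm, ← hq, min_self, max_self, min_eq_left hpm, max_eq_left hmq] at h1 h2
      -- Cauchy–Schwarz: `√(a E1) + √(r E2) ≤ √((a + r) (E1 + E2))`.
      have h4 : 2 * ((q - m) * (m - p)) ≤ a * E2 + r * E1 := by
        have h5 : ((m - p) * (q - m)) ^ 2 ≤ (a * E1) * (r * E2) := by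
          rw [mul_pow]
          exact mul_le_mul h1 h2 (sq_nonneg _) (mul_nonneg ha hE1)
        refine le_of_sq_le_sq ?_ (by positivity)
        nlinarith [sq_nonneg (a * E2 - r * E1)]
      calc (q - p) ^ 2 ≤ (a + r) * (E1 + E2) := by nlinarith
        _ ≤ _ := mul_le_mul_of_nonneg_left h3 (by positivity)
    rcases le_total (u (Γ.edge e s)) (u y) with hle | hle
    · exact main hu h hle
    · have := main (u := fun x => -u x) hu.neg h.neg (neg_le_neg hle)
      rwa [neg_sub_neg, ← neg_sub, neg_sq] at this

theorem sq_sub_le_dist_mul {u : Γ.Point → ℝ}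
    {ν : ∀ e : E, Measure (Icc (0 : ℝ) (Γ.len e))} [∀ e, IsFiniteMeasure (ν e)]
    (hu : Continuous u) (h : Γ.IsEnergyBound u ν) (x y : Γ.Point) :
    (u y - u x) ^ 2 ≤ dist x y * ∑ e, (ν e).real univ := by
  have hT : 0 ≤ ∑ e, (ν e).real univ := Finset.sum_nonneg fun e _ => measureReal_nonneg
  refine le_of_forall_pos_le_add fun ε hε => ?_
  obtain ⟨r, hr, hr'⟩ := Real.lt_sInf_add_pos (s := {r : ℝ | Γ.HasPath x y r})
    (exists_hasPath x y) (ε := ε / (∑ e, (ν e).real univ + 1)) (by positivity)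
  have hd : dist x y = sInf {r : ℝ | Γ.HasPath x y r} := rfl
  rw [← hd] at hr'
  have hr1 : Γ.HasPath x y r := hr
  calc (u y - u x) ^ 2 ≤ r * ∑ e, (ν e).real univ := hr1.sq_sub_le hu h
    _ ≤ (dist x y + ε / (∑ e, (ν e).real univ + 1)) * ∑ e, (ν e).real univ := by gcongr
    _ = dist x y * ∑ e, (ν e).real univ +
        ε * ((∑ e, (ν e).real univ) / (∑ e, (ν e).real univ + 1)) := by ring
    _ ≤ dist x y * ∑ e, (ν e).real univ + ε := by
      gcongr
      exact mul_le_of_le_one_right hε.le ((div_le_one (by positivity)).2 (by linarith))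

end MetricGraph

/-! ### Measure, compactness and the Poincaré inequality -/

namespace MetricGraph

variable {V E : Type*} (Γ : MetricGraph V E)

theorem map_val_edgeMeasure (e : E) :
    (Γ.edgeMeasure e).map Subtype.val = volume.restrict (Icc (0 : ℝ) (Γ.len e)) :=
  map_comap_subtype_coe measurableSet_Icc _

instance (e : E) : IsFiniteMeasure (Γ.edgeMeasure e) := by
  refine ⟨?_⟩
  have h : (Γ.edgeMeasure e).map Subtype.val univ = Γ.edgeMeasure e univ := by
    rw [Measure.map_apply measurable_subtype_coe MeasurableSet.univ, preimage_univ]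
  rw [← h, map_val_edgeMeasure, Measure.restrict_apply_univ]
  exact measure_Icc_lt_top

theorem integrable_edgeMeasure_iff (e : E) (f : ℝ → ℝ) :
    Integrable (fun t : Icc (0 : ℝ) (Γ.len e) => f t) (Γ.edgeMeasure e) ↔
      IntervalIntegrable f volume 0 (Γ.len e) := by
  rw [intervalIntegrable_iff_integrableOn_Icc_of_le (Γ.len_pos e).le, IntegrableOn,
    ← map_val_edgeMeasure,
    (MeasurableEmbedding.subtype_coe measurableSet_Icc).integrable_map_iff]
  rfl

theorem setIntegral_edgeMeasure (e : E) (f : ℝ → ℝ) {s t : Icc (0 : ℝ) (Γ.len e)} (hst : s ≤ t) :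
    ∫ x in Ioo s t, f x ∂Γ.edgeMeasure e = ∫ x in (s : ℝ)..t, f x := by
  have hst' : (s : ℝ) ≤ t := hst
  have h := (MeasurableEmbedding.subtype_coe measurableSet_Icc).setIntegral_map
    (μ := Γ.edgeMeasure e) f (Ioo (s : ℝ) t)
  rw [intervalIntegral.integral_of_le hst', integral_Ioc_eq_integral_Ioo]
  rw [map_val_edgeMeasure, Measure.restrict_restrict measurableSet_Ioo, inter_eq_left.2] at h
  · exact h.symm
  · exact fun x hx => ⟨s.2.1.trans hx.1.le, hx.2.le.trans t.2.2⟩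

theorem integral_edgeMeasure (e : E) (f : ℝ → ℝ) :
    ∫ x : Icc (0 : ℝ) (Γ.len e), f x ∂Γ.edgeMeasure e = ∫ x in 0..Γ.len e, f x := by
  have h := (MeasurableEmbedding.subtype_coe measurableSet_Icc).integral_map
    (μ := Γ.edgeMeasure e) f
  rw [intervalIntegral.integral_of_le (Γ.len_pos e).le, ← integral_Icc_eq_integral_Ioc,
    ← map_val_edgeMeasure]
  exact h.symm

theorem edgeMeasure_real_univ (e : E) : (Γ.edgeMeasure e).real univ = Γ.len e := by
  have h := Γ.integral_edgeMeasure e fun _ => 1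
  simpa using h

variable {Γ} in
/-- As soon as there is an edge, a connected graph has no isolated vertices: a path from a point to
an edge is trivial or starts inside an edge. -/
theorem exists_edge_eq [Nonempty E] (x : Γ.Point) : ∃ e t, Γ.edge e t = x := by
  obtain ⟨e⟩ := ‹Nonempty E›
  obtain ⟨r, hr⟩ := exists_hasPath x (Γ.edge e (Γ.start e))
  cases hr with
  | nil => exact ⟨_, _, rfl⟩
  | cons e s t y r h => exact ⟨_, _, rfl⟩

instance [Finite V] [Finite E] : CompactSpace Γ.Point := by
  refine ⟨?_⟩
  have h : (univ : Set Γ.Point) = range Γ.vertex ∪ ⋃ e, range (Γ.edge e) := by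
    refine (eq_univ_of_forall fun x => ?_).symm
    induction x using Quot.ind with
    | mk p =>
      rcases p with v | ⟨e, t⟩
      · exact Or.inl ⟨v, rfl⟩
      · exact Or.inr (mem_iUnion.2 ⟨e, t, rfl⟩)
  rw [h]
  exact (finite_range _).isCompact.union
    (isCompact_iUnion fun e => isCompact_range (Γ.continuous_edge e))

variable [Fintype E]

instance : IsFiniteMeasure Γ.measure := by
  unfold measure; infer_instance

theorem map_edge_le_measure (e : E) : (Γ.edgeMeasure e).map (Γ.edge e) ≤ Γ.measure := by
  classical
  rw [measure, ← Finset.add_sum_erase _ _ (Finset.mem_univ e)]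
  exact Measure.le_add_right le_rfl

theorem memLp_edge {f : Γ.Point → ℝ} {p : ENNReal} (hf : MemLp f p Γ.measure) (e : E) :
    MemLp (fun t => f (Γ.edge e t)) p (Γ.edgeMeasure e) :=
  (hf.mono_measure (Γ.map_edge_le_measure e)).comp_of_map
    (Γ.continuous_edge e).measurable.aemeasurable

theorem integral_measure {f : Γ.Point → ℝ} (hf : Integrable f Γ.measure) :
    ∫ x, f x ∂Γ.measure = ∑ e, ∫ t, f (Γ.edge e t) ∂Γ.edgeMeasure e := by
  rw [measure, integral_finsetSum_measure fun e _ =>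
    hf.mono_measure (Γ.map_edge_le_measure e)]
  refine Finset.sum_congr rfl fun e _ => ?_
  exact integral_map (Γ.continuous_edge e).measurable.aemeasurable
    (hf.mono_measure (Γ.map_edge_le_measure e)).aestronglyMeasurable

theorem measure_real_univ : Γ.measure.real univ = Γ.totalLength := by
  have h := Γ.integral_measure (f := fun _ => 1) (integrable_const _)
  simpa [edgeMeasure_real_univ, totalLength] using h

variable {Γ}

theorem _root_.Continuous.integrable_metricGraph_measure [Finite V] {f : Γ.Point → ℝ}
    (hf : Continuous f) : Integrable f Γ.measure :=
  hf.integrable_of_hasCompactSupport (HasCompactSupport.of_compactSpace f)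

theorem continuous_integral_dist [Finite V] :
    Continuous fun x : Γ.Point => ∫ y, dist x y ∂Γ.measure := by
  refine (LipschitzWith.of_dist_le' (K := Γ.totalLength) fun x y => ?_).continuous
  rw [dist_eq_norm, ← integral_sub
    (Continuous.integrable_metricGraph_measure (by fun_prop))
    (Continuous.integrable_metricGraph_measure (by fun_prop)), ← measure_real_univ, mul_comm]
  exact norm_integral_le_of_norm_le_const
    (Filter.Eventually.of_forall fun z => abs_dist_sub_le x y z)

/-- An `H¹` function with derivative `g` has energy at most `g² dx`. -/
theorem IsH1.isEnergyBound {u g : Γ.Point → ℝ} (h : Γ.IsH1 u g) :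
    Γ.IsEnergyBound u fun e =>
      (Γ.edgeMeasure e).withDensity fun t => ENNReal.ofReal (g (Γ.edge e t) ^ 2) := by
  obtain ⟨hu, -, hw, hg⟩ := h
  intro e s t hst
  have hst' : (s : ℝ) ≤ t := hst
  have hl := Γ.len_pos e
  set U := IccExtend hl.le fun t => u (Γ.edge e t) with hU
  set G := IccExtend hl.le fun t => g (Γ.edge e t) with hG
  have eU : ∀ x : Icc (0 : ℝ) (Γ.len e), U x = u (Γ.edge e x) := fun x => IccExtend_val _ _ x
  have eG : ∀ x : Icc (0 : ℝ) (Γ.len e), G x = g (Γ.edge e x) := fun x => IccExtend_val _ _ x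
  have hge := Γ.memLp_edge hg e
  have hG1 : IntervalIntegrable G volume 0 (Γ.len e) := by
    rw [← integrable_edgeMeasure_iff]
    simp only [eG]
    exact hge.integrable one_le_two
  have hG2 : IntervalIntegrable (fun x => G x ^ 2) volume 0 (Γ.len e) := by
    rw [← integrable_edgeMeasure_iff]
    simp only [eG]
    exact hge.integrable_sq
  have hUc : Continuous U := (hu.comp (Γ.continuous_edge e)).Icc_extend'
  have hsub := sub_eq_integral_of_weakDeriv hl hUc.continuousOn hG1 (fun φ h1 h2 h3 => by
    rw [← integral_edgeMeasure, ← integral_edgeMeasure]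
    simp only [eU, eG]
    exact hw e φ h1 h2 h3) s.2 t.2
  have hss : uIcc (s : ℝ) t ⊆ uIcc 0 (Γ.len e) := by
    rw [uIcc_of_le hl.le]
    exact ordConnected_Icc.uIcc_subset s.2 t.2
  rw [eU, eU] at hsub
  rw [hsub]
  refine (sq_intervalIntegral_le hst' (hG1.mono_set hss) (hG2.mono_set hss)).trans (le_of_eq ?_)
  rw [measureReal_def, withDensity_apply _ measurableSet_Ioo,
    ← ofReal_integral_eq_lintegral_ofReal hge.integrable_sq.integrableOn
      (Filter.Eventually.of_forall fun x => sq_nonneg _),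
    ENNReal.toReal_ofReal (integral_nonneg fun x => sq_nonneg _),
    ← setIntegral_edgeMeasure _ _ _ hst]
  simp only [eG]

theorem IsH1.sq_sub_le {u g : Γ.Point → ℝ} (h : Γ.IsH1 u g) (x y : Γ.Point) :
    (u x - u y) ^ 2 ≤ dist x y * ∫ z, g z ^ 2 ∂Γ.measure := by
  have hg := fun e => (Γ.memLp_edge h.2.2.2 e).integrable_sq
  have hfin : ∀ e, IsFiniteMeasure ((Γ.edgeMeasure e).withDensity
      fun t => ENNReal.ofReal (g (Γ.edge e t) ^ 2)) := fun e =>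
    isFiniteMeasure_withDensity_ofReal (hg e).2
  have := sq_sub_le_dist_mul h.1 h.isEnergyBound x y
  rw [← neg_sub, neg_sq]
  refine this.trans (le_of_eq ?_)
  rw [Γ.integral_measure h.2.2.2.integrable_sq]
  congr 1
  refine Finset.sum_congr rfl fun e _ => ?_
  rw [measureReal_def, withDensity_apply _ MeasurableSet.univ, Measure.restrict_univ,
    ← ofReal_integral_eq_lintegral_ofReal (hg e) (Filter.Eventually.of_forall fun x => sq_nonneg _),
    ENNReal.toReal_ofReal (integral_nonneg fun x => sq_nonneg _)]

/-- Poincaré inequality with the mean distance: integrate `(u x - u y)² ≤ dist x y ∫ g²` over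
`y` and then over `x`. -/
theorem IsH1.two_mul_integral_sq_le [Finite V] (hL : 0 < Γ.totalLength) {u g : Γ.Point → ℝ}
    (h : Γ.IsH1 u g) (h0 : ∫ x, u x ∂Γ.measure = 0) :
    2 * ∫ x, u x ^ 2 ∂Γ.measure ≤
      Γ.totalLength * Γ.meanDistance * ∫ x, g x ^ 2 ∂Γ.measure := by
  set L := Γ.totalLength with hLdef
  set G := ∫ x, g x ^ 2 ∂Γ.measure
  set S := ∫ x, u x ^ 2 ∂Γ.measure with hS
  have hu := h.1
  have hu2 : Integrable (fun x => u x ^ 2) Γ.measure := (hu.pow 2).integrable_metricGraph_measure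
  have hui : Integrable u Γ.measure := hu.integrable_metricGraph_measure
  have h1 : ∀ x, u x ^ 2 * L + S ≤ (∫ y, dist x y ∂Γ.measure) * G := by
    intro x
    have hmono : ∫ y, (u x - u y) ^ 2 ∂Γ.measure ≤ ∫ y, dist x y * G ∂Γ.measure :=
      integral_mono (Continuous.integrable_metricGraph_measure (by fun_prop))
        (Continuous.integrable_metricGraph_measure (by fun_prop)) fun y => h.sq_sub_le x y
    have e : (fun y => (u x - u y) ^ 2) = fun y => u x ^ 2 - 2 * u x * u y + u y ^ 2 := by
      ext y; ring
    have hi : Integrable (fun y => u x ^ 2 - 2 * u x * u y) Γ.measure :=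
      (integrable_const _).sub (hui.const_mul _)
    rw [integral_mul_const, e, integral_add hi hu2,
      integral_sub (integrable_const _) (hui.const_mul _), integral_const_mul, h0, integral_const,
      measure_real_univ, smul_eq_mul, ← hS, ← hLdef] at hmono
    linarith
  have h2 := integral_mono ((hu2.mul_const L).add (integrable_const S))
    (continuous_integral_dist.integrable_metricGraph_measure.mul_const G) h1
  have h3 : ∫ x, (u x ^ 2 * L + S) ∂Γ.measure = L * (2 * S) := by
    rw [integral_add (hu2.mul_const L) (integrable_const S), integral_mul_const, integral_const,
      measure_real_univ, smul_eq_mul, ← hS, ← hLdef]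
    ring
  have h4 : ∫ x, (∫ y, dist x y ∂Γ.measure) * G ∂Γ.measure = L * (L * Γ.meanDistance * G) := by
    rw [integral_mul_const, meanDistance]
    simp only [meanDistanceFrom]
    rw [integral_const_mul, ← hLdef]
    field_simp
  refine le_of_mul_le_mul_left ?_ hL
  rw [← h3, ← h4]
  exact h2

theorem integral_sq_pos [Finite V] [Nonempty E] {u : Γ.Point → ℝ} (hu : Continuous u)
    (hne : u ≠ 0) : 0 < ∫ x, u x ^ 2 ∂Γ.measure := by
  obtain ⟨x, hx⟩ := Function.ne_iff.1 hne
  obtain ⟨e, t, rfl⟩ := exists_edge_eq x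
  rw [Γ.integral_measure (f := fun x => u x ^ 2) (hu.pow 2).integrable_metricGraph_measure]
  refine Finset.sum_pos' (fun e _ => integral_nonneg fun t => sq_nonneg _)
    ⟨e, Finset.mem_univ e, ?_⟩
  have hl := Γ.len_pos e
  have hc : Continuous fun t => u (Γ.edge e t) ^ 2 := (hu.comp (Γ.continuous_edge e)).pow 2
  have h := Γ.integral_edgeMeasure e (IccExtend hl.le fun t => u (Γ.edge e t) ^ 2)
  simp only [IccExtend_val] at h
  rw [h]
  refine intervalIntegral.integral_pos hl hc.Icc_extend'.continuousOn
    (fun x _ => sq_nonneg _) ⟨t, t.2, ?_⟩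
  rw [IccExtend_val]
  exact sq_pos_of_ne_zero hx

end MetricGraph

/-! ### Functions supported on one edge -/

namespace MetricGraph

variable {V E : Type*} (Γ : MetricGraph V E)

open Classical in
/-- The function on the graph that equals `θ` on the edge `e₀` and `0` elsewhere. The values of `θ`
at the two ends of the edge have to vanish for it to be well defined. -/
noncomputable def edgeExtend (e₀ : E) (θ : ℝ → ℝ) (h0 : θ 0 = 0) (h1 : θ (Γ.len e₀) = 0) :
    Γ.Point → ℝ :=
  Quot.lift (Sum.elim (fun _ => 0) fun p => if p.1 = e₀ then θ p.2 else 0) (by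
    rintro _ _ (e | e)
    all_goals
      simp only [Sum.elim_inl, Sum.elim_inr, ite_eq_right_iff]
      rintro rfl
      assumption)

variable {Γ} {e₀ : E} {θ : ℝ → ℝ} (h0 : θ 0 = 0) (h1 : θ (Γ.len e₀) = 0)

open Classical in
theorem edgeExtend_edge (e : E) (t : Icc (0 : ℝ) (Γ.len e)) :
    Γ.edgeExtend e₀ θ h0 h1 (Γ.edge e t) = if e = e₀ then θ t else 0 := rfl

theorem continuous_edgeExtend {K : NNReal} (hθ : LipschitzWith K θ) :
    Continuous (Γ.edgeExtend e₀ θ h0 h1) := by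
  set f := Γ.edgeExtend e₀ θ h0 h1 with hf
  have hpath : ∀ x y r, Γ.HasPath x y r → |f x - f y| ≤ K * r := by
    intro x y r h
    induction h with
    | nil => simp
    | cons e s t y r _ ih =>
      have h2 : |f (Γ.edge e s) - f (Γ.edge e t)| ≤ K * |(s : ℝ) - t| := by
        rw [hf, edgeExtend_edge, edgeExtend_edge]
        split_ifs
        · exact hθ.dist_le_mul s t
        · rw [sub_zero, abs_zero]
          positivity
      rw [mul_add]
      exact (abs_sub_le _ _ _).trans (add_le_add h2 ih)
  refine (LipschitzWith.of_dist_le_mul (K := K) fun x y => ?_).continuous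
  refine le_of_forall_pos_le_add fun ε hε => ?_
  obtain ⟨r, hr, hr'⟩ := Real.lt_sInf_add_pos (s := {r : ℝ | Γ.HasPath x y r})
    (exists_hasPath x y) (ε := ε / (K + 1)) (by positivity)
  have hd : dist x y = sInf {r : ℝ | Γ.HasPath x y r} := rfl
  rw [← hd] at hr'
  have hK : (K : ℝ) * (ε / (K + 1)) ≤ ε := by
    rw [mul_div_assoc', div_le_iff₀ (by positivity)]
    nlinarith
  have hK0 : (0 : ℝ) ≤ K := K.2
  calc dist (f x) (f y) ≤ K * r := hpath x y r hr
    _ ≤ K * (dist x y + ε / (K + 1)) := by gcongr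
    _ ≤ K * dist x y + ε := by rw [mul_add]; gcongr

theorem isH1_edgeExtend [Fintype E] [Finite V] (hθ : ContDiff ℝ ∞ θ) (hc : HasCompactSupport θ)
    (h0' : deriv θ 0 = 0) (h1' : deriv θ (Γ.len e₀) = 0) :
    Γ.IsH1 (Γ.edgeExtend e₀ θ h0 h1) (Γ.edgeExtend e₀ (deriv θ) h0' h1') := by
  have hθ' : ContDiff ℝ ∞ (deriv θ) := (contDiff_infty_iff_deriv.1 hθ).2
  obtain ⟨K, hK⟩ := hθ.lipschitzWith_of_hasCompactSupport hc (by simp)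
  obtain ⟨K', hK'⟩ := hθ'.lipschitzWith_of_hasCompactSupport hc.deriv (by simp)
  have hu := continuous_edgeExtend h0 h1 hK
  have hg := continuous_edgeExtend h0' h1' hK'
  refine ⟨hu, hu.memLp_of_hasCompactSupport (HasCompactSupport.of_compactSpace _), ?_,
    hg.memLp_of_hasCompactSupport (HasCompactSupport.of_compactSpace _)⟩
  intro e φ hφ _ _
  simp only [edgeExtend_edge]
  split_ifs with he
  · subst he
    rw [Γ.integral_edgeMeasure e fun t => θ t * deriv φ t,
      Γ.integral_edgeMeasure e fun t => deriv θ t * φ t,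
      intervalIntegral.integral_mul_deriv_eq_deriv_mul (u' := deriv θ)
        (fun x _ => (hθ.differentiable (by simp) x).hasDerivAt)
        (fun x _ => (hφ.differentiable (by simp) x).hasDerivAt)
        (hθ'.continuous.intervalIntegrable _ _)
        ((hφ.continuous_deriv (by simp)).intervalIntegrable _ _), h0, h1]
    ring
  · simp

/-- The Rayleigh quotients defining the spectral gap range over a nonempty set: the derivative of a
bump function on an edge has mean value zero. -/
theorem exists_isH1_ne_zero_integral_eq_zero [Fintype E] [Finite V] [Nonempty E] :
    ∃ u g : Γ.Point → ℝ, Γ.IsH1 u g ∧ u ≠ 0 ∧ ∫ x, u x ∂Γ.measure = 0 := by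
  obtain ⟨e₀⟩ := ‹Nonempty E›
  obtain ⟨ψ, hψ, hc, hs, hψ1⟩ := exists_testFunction_integral_eq_one (Γ.len_pos e₀)
  have hend : ∀ x, x ∉ Ioo 0 (Γ.len e₀) → ψ x = 0 ∧ deriv ψ x = 0 ∧ deriv (deriv ψ) x = 0 := by
    intro x hx
    have hx' : x ∉ tsupport ψ := fun h => hx (hs h)
    have hx1 : x ∉ tsupport (deriv ψ) := fun h => hx' (tsupport_deriv_subset h)
    exact ⟨image_eq_zero_of_notMem_tsupport hx', image_eq_zero_of_notMem_tsupport hx1,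
      image_eq_zero_of_notMem_tsupport fun h => hx1 (tsupport_deriv_subset h)⟩
  have e0 := hend 0 (by simp)
  have e1 := hend (Γ.len e₀) (by simp)
  have hψ' : ContDiff ℝ ∞ (deriv ψ) := (contDiff_infty_iff_deriv.1 hψ).2
  have hH := isH1_edgeExtend e0.2.1 e1.2.1 hψ' hc.deriv e0.2.2 e1.2.2
  refine ⟨_, _, hH, fun h => ?_, ?_⟩
  · have hd : ∀ x, deriv ψ x = 0 := by
      intro x
      by_cases hx : x ∈ Ioo 0 (Γ.len e₀)
      · have := congrFun h (Γ.edge e₀ ⟨x, Ioo_subset_Icc_self hx⟩)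
        rw [edgeExtend_edge, if_pos rfl] at this
        exact this
      · exact (hend x hx).2.1
    have hz : ∀ x, ψ x = 0 := fun x =>
      (is_const_of_deriv_eq_zero (hψ.differentiable (by simp)) hd x 0).trans e0.1
    simp [hz] at hψ1
  · rw [Γ.integral_measure hH.1.integrable_metricGraph_measure]
    refine Finset.sum_eq_zero fun e _ => ?_
    simp only [edgeExtend_edge]
    split_ifs with he
    · subst he
      rw [integral_edgeMeasure, intervalIntegral.integral_deriv_eq_sub
        (fun x _ => hψ.differentiable (by simp) x) (hψ'.continuous.intervalIntegrable _ _),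
        e0.1, e1.1, sub_zero]
    · simp

end MetricGraph

/-! ### The lower bound for the spectral gap -/

theorem mainTheorem3 {V E : Type*} [Finite V] [Fintype E] (Γ : MetricGraph V E)
    (hL : 0 < Γ.totalLength) :
    1 / Γ.totalLength ≤ Γ.spectralGap * Γ.meanDistance := by
  have hE : Nonempty E := by
    by_contra hE
    rw [not_nonempty_iff] at hE
    simp [MetricGraph.totalLength] at hL
  obtain ⟨u₀, g₀, hH₀, hne₀, hmean₀⟩ := Γ.exists_isH1_ne_zero_integral_eq_zero
  have hρ : 0 < Γ.meanDistance := by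
    have h1 := hH₀.two_mul_integral_sq_le hL hmean₀
    have h2 := MetricGraph.integral_sq_pos hH₀.1 hne₀
    have h3 : 0 ≤ ∫ x, g₀ x ^ 2 ∂Γ.measure := integral_nonneg fun x => sq_nonneg _
    exact pos_of_mul_pos_right (pos_of_mul_pos_left (by linarith) h3) hL.le
  rw [← div_le_iff₀ hρ]
  refine le_csInf ⟨_, u₀, g₀, hH₀, hne₀, hmean₀, rfl⟩ ?_
  rintro _ ⟨u, g, hH, hne, hmean, rfl⟩
  have h1 := hH.two_mul_integral_sq_le hL hmean
  have h2 := MetricGraph.integral_sq_pos hH.1 hne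
  rw [div_div, div_le_div_iff₀ (by positivity) h2]
  linarith
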